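/- **Setting.** A hypergraph $H=(V,E)$ has vertex set $V=\{0,\dots,n-1\}$ (a vertex's name is its ID) and a set $E$ of non-empty subsets of $V$ as edges; it is $r$-uniform if all edges have exactly $r$ vertices. A *triangle* of $H$ is a closed path $v_0e_0v_1e_1v_2e_2v_0$ of length three, i.e. $e_i\in E$ and $v_i,v_{i+1}\in e_i$ (indices mod $3$), considered up to the choice of the starting vertex and of the direction; it is *simple* if $v_0,v_1,v_2$ are distinct and $e_0,e_1,e_2$ are distinct, and *induced* if moreover $v_i\notin e_{i+1}$ for all $i$. In the *triangle enumeration* task each vertex outputs a set of triangles of $H$ so that every triangle of $H$ is output by precisely one vertex. The task has three variants, in which "triangle" means any closed path of length three, a simple one, or an induced one. Algorithms are synchronous, with unrestricted local computation and with random coins (private or shared). Initially each vertex knows $n$, its own ID and, for every incident edge, the list of its vertices ($\mathrm{KT}_1$). In each round, along each edge $e$, vertices of $e$ may send messages of $B$ bits to other vertices of $e$ (or stay silent), subject to the restriction of the model: * EC (edge clique): each $v\in e$ may send a separate message over $e$ to each other vertex of $e$; * EB (edge broadcast): each $v\in e$ sends the same message over $e$ to all other vertices of $e$; * EU (edge unicast):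 each $v\in e$ sends over $e$ to at most one other vertex of $e$; * ES (edge solocast): at most one vertex of $e$ sends over $e$, and it sends the same message to all other vertices of $e$; * EP (edge paircast): all messages sent over $e$ are exchanged between two vertices of $e$. **Statement.** For every constant $r\ge 2$ there are a constant $p<1$ and, for every $n$, a probability distribution $\mathcal D_n$ on $r$-uniform hypergraphs with $n$ vertices such that the following holds. In each of the models EC, EB, EU, ES and EP with $B=O(\log n)$, and for each of the three variants of the task, every (randomized or deterministic) algorithm that, on an input $H\sim\mathcal D_n$, has correctly solved triangle enumeration after $T$ rounds with probability at least $p$ (over $H$ and the independent coins) satisfies $$T=\Omega\!\left(\frac{n^{1/3}}{\log n}\right).$$ That is, for every $K$ there are $c>0$ and $N$ (depending only on $r$ and $K$) such that $T\ge c\,n^{1/3}/\log n$ whenever $n\ge N$ and $B\le K\log n$. -/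

import Mathlib

universe u

namespace HyperCongest

/-- `H` is an `r`-uniform hypergraph with vertex set `{0, …, n-1}`: all of `Fin n` are vertices,
and every edge has exactly `r` vertices. The name of a vertex in `Fin n` is also its unique ID. -/
def IsUniform {n : ℕ} (r : ℕ) (H : Hypergraph (Fin n)) : Prop :=
  H.vertexSet = Set.univ ∧ ∀ e ∈ H.edgeSet, e.ncard = r

/-- The edges incident to `v`, each given as the set of (the IDs of) its vertices. Together with
the ID of `v` this is the 1-neighbourhood of `v`: it determines `deg v` and `N(v)`. -/
def incident {n : ℕ} (H : Hypergraph (Fin n)) (v : Fin n) : Set (Set (Fin n)) :=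
  {e | e ∈ H.edgeSet ∧ v ∈ e}

/-! ### Triangles -/

/-- A cyclic sequence `v₀ e₀ v₁ e₁ v₂ e₂ (v₀)` of vertices and vertex sets;
indices are taken modulo `3`. -/
structure ThreeCycle (n : ℕ) where
  vert : Fin 3 → Fin n
  edge : Fin 3 → Set (Fin n)

/-- Two sequences describe the same cycle: one arises from the other by changing the starting
vertex or (second alternative) also the direction of traversal. -/
def ThreeCycle.Same {n : ℕ} (s t : ThreeCycle n) : Prop :=
  ∃ k : Fin 3,
    (∀ i, s.vert i = t.vert (i + k) ∧ s.edge i = t.edge (i + k)) ∨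
    (∀ i, s.vert i = t.vert (k - i) ∧ s.edge i = t.edge (k - i - 1))

/-- The three notions of triangle: any closed path of length three, a simple one, an induced one. -/
inductive TriangleKind
  | closed
  | simple
  | induced

/-- `t` is a closed path of length three in `H`: `e_i` is an edge containing `v_i` and `v_{i+1}`. -/
def ThreeCycle.IsClosedPath {n : ℕ} (H : Hypergraph (Fin n)) (t : ThreeCycle n) : Prop :=
  ∀ i, t.edge i ∈ H.edgeSet ∧ t.vert i ∈ t.edge i ∧ t.vert (i + 1) ∈ t.edge i

/-- The vertices are pairwise distinct and the edges are pairwise distinct. -/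
def ThreeCycle.IsSimple {n : ℕ} (t : ThreeCycle n) : Prop :=
  Function.Injective t.vert ∧ Function.Injective t.edge

/-- Simple, and no edge contains the vertex opposite to it. -/
def ThreeCycle.IsInduced {n : ℕ} (t : ThreeCycle n) : Prop :=
  t.IsSimple ∧ ∀ i, t.vert i ∉ t.edge (i + 1)

/-- `t` is a triangle of `H`, of the given kind. -/
def ThreeCycle.IsTriangle {n : ℕ} (H : Hypergraph (Fin n)) (t : ThreeCycle n) : TriangleKind → Prop
  | .closed => t.IsClosedPath H
  | .simple => t.IsClosedPath H ∧ t.IsSimple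
  | .induced => t.IsClosedPath H ∧ t.IsInduced

/-- The family of outputs `S v` is a correct triangle enumeration of `H`: only triangles of `H` are
output, and every triangle of `H` is output by precisely one vertex. Sequences that describe the
same cycle are regarded as the same triangle. -/
def IsEnumeration {n : ℕ} (kind : TriangleKind) (H : Hypergraph (Fin n))
    (S : Fin n → Set (ThreeCycle n)) : Prop :=
  (∀ v, ∀ t ∈ S v, t.IsTriangle H kind) ∧
  (∀ t : ThreeCycle n, t.IsTriangle H kind → ∃! v, ∃ s ∈ S v, s.Same t)

/-! ### Algorithms and their executions -/

/-- A `B`-bit message. -/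
abbrev Msg (B : ℕ) : Type := Fin B → Bool

/-- A synchronous message passing algorithm for hypergraphs on `n` vertices, with messages of `B`
bits and random coins from `Ω`. Local computation is unrestricted.
* `init v I ω` is the initial state of the vertex with ID `v` whose set of incident edges is `I`,
  when the outcome of the coins is `ω`. Coins may be shared; for private coins, take for `Ω` a
  product over the vertices and let `init v` look only at the coordinate of `v`.
* `send s e w` is the message (`none`: no message) that a vertex in state `s` sends to `w` over
  the incident edge `e`.
* `receive s m` is the new state of a vertex that was in state `s` and received from each vertex
  `x`, over each edge `e`, the message `m e x` (`none`: no message).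
* `output s` is the set of triangles that a vertex in state `s` outputs. -/
structure Algorithm (n B : ℕ) (Ω : Type u) where
  State : Type u
  init : Fin n → Set (Set (Fin n)) → Ω → State
  send : State → Set (Fin n) → Fin n → Option (Msg B)
  receive : State → (Set (Fin n) → Fin n → Option (Msg B)) → State
  output : State → Set (ThreeCycle n)

variable {n B : ℕ} {Ω : Type u}

open Classical in
/-- The message that goes over `e` from `x` to `w` when the vertices are in the states `σ`: there
can be one only if `e` is an edge of `H` and `x`, `w` are distinct vertices of `e`. -/
noncomputable def Algorithm.traffic (A : Algorithm n B Ω) (H : Hypergraph (Fin n))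
    (σ : Fin n → A.State) (e : Set (Fin n)) (x w : Fin n) : Option (Msg B) :=
  if e ∈ H.edgeSet ∧ x ∈ e ∧ w ∈ e ∧ x ≠ w then A.send (σ x) e w else none

/-- The states of all vertices after `t` rounds on the input `H` with coins `ω`. -/
noncomputable def Algorithm.states (A : Algorithm n B Ω) (H : Hypergraph (Fin n)) (ω : Ω) :
    ℕ → Fin n → A.State
  | 0 => fun v => A.init v (incident H v) ω
  | t + 1 => fun v =>
      A.receive (A.states H ω t v) (fun e x => A.traffic H (A.states H ω t) e x v)

/-- With coins `ω`, the outputs after `T` rounds on `H` are a correct triangle enumeration. -/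
def Algorithm.Solves (A : Algorithm n B Ω) (kind : TriangleKind) (T : ℕ) (H : Hypergraph (Fin n))
    (ω : Ω) : Prop :=
  IsEnumeration kind H (fun v => A.output (A.states H ω T v))

/-- The probability that the outputs after `T` rounds are correct, when the input is drawn from `D`
and, independently, the coins are drawn from `μ`. -/
noncomputable def Algorithm.successProb [MeasurableSpace Ω] (A : Algorithm n B Ω)
    (kind : TriangleKind) (T : ℕ) (D : PMF (Hypergraph (Fin n)))
    (μ : MeasureTheory.Measure Ω) : ENNReal :=
  ∑' H, D H * μ {ω | A.Solves kind T H ω}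

/-! ### The five communication models -/

/-- EDGE CLIQUE, EDGE BROADCAST, EDGE UNICAST, EDGE SOLOCAST, EDGE PAIRCAST. -/
inductive Model
  | EC
  | EB
  | EU
  | ES
  | EP

/-- The restriction that a model puts on the messages `m x w` sent from `x` to `w`, for distinct
`x, w ∈ e`, over one edge `e` in one round. -/
def Model.Allows (e : Set (Fin n)) (m : Fin n → Fin n → Option (Msg B)) : Model → Prop
  | .EC => True
  | .EB => ∀ x ∈ e, ∃ a : Option (Msg B), ∀ w ∈ e, w ≠ x → m x w = a
  | .EU => ∀ x ∈ e, ∀ w ∈ e, ∀ w' ∈ e, m x w ≠ none → m x w' ≠ none → w = w'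
  | .ES => ∃ x ∈ e, (∃ a : Option (Msg B), ∀ w ∈ e, w ≠ x → m x w = a) ∧
      ∀ y ∈ e, y ≠ x → ∀ w ∈ e, m y w = none
  | .EP => ∃ x ∈ e, ∃ y ∈ e, ∀ z ∈ e, ∀ w ∈ e, m z w ≠ none → (z = x ∧ w = y) ∨ (z = y ∧ w = x)

/-- On `r`-uniform inputs, the first `T` rounds of `A` comply with the model, whatever the coins. -/
def Algorithm.Obeys (A : Algorithm n B Ω) (M : Model) (r T : ℕ) : Prop :=
  ∀ H : Hypergraph (Fin n), IsUniform r H → ∀ ω : Ω, ∀ t < T, ∀ e ∈ H.edgeSet,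
    M.Allows e (A.traffic H (A.states H ω t) e)

end HyperCongest

/-! Take `r + 1` parts of `m = n / (r + 1)` vertices, three of them the core, and choose each of `3
* m ^ 2` potential edges with probability 1/2. Every vertex lies on at most `3 * m` potential edges,
and each of the `m ^ 3` core triples is an induced triangle with probability 1/8. Averaging fixes
the coins (`exists_coins`). With noticeable probability the input is solved and has at least `m ^ 3
/ 16` core triangles, so some vertex finds `s ≥ m ^ 3 / (16 * n)` of them. By Loomis–Whitney
(`card_sq_le_cube_of_projections`) these involve `k ≥ s ^ (2/3)` edges, of order `n ^ (4/3)`. A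
state determines the output, and a correct output forces its edges to be present, so each state is
compatible with a fraction at most `2 ^ (-k)` of the inputs (`card_solved_by_le`). A vertex reaches
at most `2 ^ R` states with `R = O(m * (B + 1) * T)` for `T ≥ 1` (`card_states_le`); this count
allows a separate message from every vertex of every incident edge, so it covers all five models.
Hence `k ≤ R + O(n)`, which gives the bound on `T` (`exists_learned`, `rounds_lower_bound`). -/

namespace HyperCongest

open Finset

/-! ### Counting lemmas -/

/-- The discrete Loomis–Whitney inequality in dimension three: `S` is determined by its three
coordinate projections, each of which lies in a set with at most `k` elements. -/
theorem card_sq_le_cube_of_projections {α : Type*} (S : Finset (Fin 3 → α))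
    (E : Fin 3 → Finset (α × α)) (hE : ∀ x ∈ S, ∀ i, (x i, x (i + 1)) ∈ E i) (k : ℕ)
    (hk : ∀ i, #(E i) ≤ k) : #S ^ 2 ≤ k ^ 3 := by
  classical
  let fib : α × α → Finset (Fin 3 → α) := fun p => {x ∈ S | (x 0, x 1) = p}
  have hS : #S = ∑ p ∈ E 0, #(fib p) :=
    card_eq_sum_card_fiberwise fun x hx => by simpa using hE x hx 0
  -- Two points `x`, `y` over the same `p` are recovered from `(x 1, x 2)` and `(y 2, y 0)`, since
  -- they share coordinates 0 and 1. Cauchy–Schwarz then finishes.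
  have hpairs : ∑ p ∈ E 0, #(fib p) ^ 2 ≤ #(E 1) * #(E 2) := by
    rw [← card_product, Finset.sum_congr rfl fun p _ => by rw [sq, ← card_product],
      ← card_sigma (E 0) fun p => fib p ×ˢ fib p]
    refine card_le_card_of_injOn (fun z => ((z.2.1 1, z.2.1 2), (z.2.2 2, z.2.2 0))) ?_ ?_
    · rintro ⟨p, x, y⟩ h
      simp only [coe_sigma, Set.mem_sigma_iff, mem_coe, mem_product, fib, mem_filter] at h
      simp only [coe_product, Set.mem_prod, mem_coe]
      exact ⟨by simpa using hE x h.2.1.1 1, by simpa using hE y h.2.2.1 2⟩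
    · rintro ⟨p, x, y⟩ h ⟨p', x', y'⟩ h' heq
      simp only [coe_sigma, Set.mem_sigma_iff, mem_coe, mem_product, fib, mem_filter] at h h'
      obtain ⟨-, ⟨-, hx⟩, -, hy⟩ := h
      obtain ⟨-, ⟨-, hx'⟩, -, hy'⟩ := h'
      simp only [Prod.mk.injEq] at heq
      obtain ⟨⟨h1, h2⟩, h3, h4⟩ := heq
      subst hx hx'
      simp only [Prod.mk.injEq] at hy hy'
      have e0 : x 0 = x' 0 := by rw [← hy.1, ← hy'.1, h4]
      have ex : x = x' := by
        funext i
        fin_cases i <;> assumption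
      have ey : y = y' := by
        funext i
        fin_cases i
        · exact h4
        · exact hy.2.trans (h1.trans hy'.2.symm)
        · exact h3
      rw [ex, ey]
  calc #S ^ 2 = (∑ p ∈ E 0, #(fib p)) ^ 2 := by rw [hS]
    _ ≤ #(E 0) * ∑ p ∈ E 0, #(fib p) ^ 2 := sq_sum_le_card_mul_sum_sq
    _ ≤ k * (k * k) :=
      Nat.mul_le_mul (hk 0) (hpairs.trans (Nat.mul_le_mul (hk 1) (hk 2)))
    _ = k ^ 3 := by ring

/-- The number of Boolean functions that are `true` on `F`. -/
theorem card_true_on_mul {α : Type*} [Fintype α] [DecidableEq α] (F : Finset α) :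
    #{c : α → Bool | ∀ a ∈ F, c a = true} * 2 ^ #F = 2 ^ Fintype.card α := by
  have h : ({c : α → Bool | ∀ a ∈ F, c a = true} : Finset (α → Bool)) =
      Fintype.piFinset fun a => if a ∈ F then {true} else univ := by
    ext c
    simp only [mem_filter, mem_univ, true_and, Fintype.mem_piFinset]
    refine forall_congr' fun a => ?_
    by_cases ha : a ∈ F <;> simp [ha]
  rw [h, Fintype.card_piFinset, ← card_univ, ← prod_const (s := univ), ← prod_const (s := F),
    ← prod_filter_mul_prod_filter_not univ (· ∈ F), ← prod_filter_mul_prod_filter_not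
      (univ : Finset α) (· ∈ F) (fun _ => 2)]
  have h1 : ∏ x with x ∈ F, #(if x ∈ F then ({true} : Finset Bool) else univ) = 1 :=
    prod_eq_one fun x hx => by simp [(mem_filter.1 hx).2]
  have h2 : ∏ x with x ∉ F, #(if x ∈ F then ({true} : Finset Bool) else univ) =
      ∏ x with x ∉ F, 2 :=
    prod_congr rfl fun x hx => by simp [(mem_filter.1 hx).2]
  rw [h1, h2, one_mul, mul_comm]
  simp

/-- Functions with values in `Option β` that vanish outside `Q`. -/
theorem card_le_of_support {α β γ : Type*} [Fintype γ] (Q : Finset (Σ _ : α, β))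
    (F : Finset (α → β → Option γ)) (hF : ∀ g ∈ F, ∀ a b, (⟨a, b⟩ : Σ _ : α, β) ∉ Q → g a b = none) :
    #F ≤ (Fintype.card γ + 1) ^ #Q := by
  classical
  have := card_le_card_of_injOn (s := F) (t := (univ : Finset (Q → Option γ)))
    (fun g q => g q.1.1 q.1.2) (fun _ _ => by simp) (by
      intro g hg g' hg' h
      funext a b
      by_cases hab : (⟨a, b⟩ : Σ _ : α, β) ∈ Q
      · exact congrFun h ⟨_, hab⟩
      · rw [hF g hg a b hab, hF g' hg' a b hab])
  simpa using this

/-! ### The number of states of a vertex -/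

variable {n B : ℕ} {Ω : Type u}

open Classical in
/-- If, over a family of inputs, all edges at `v` come from `E` and have at most `r` vertices, then
`v` can be in at most `2 ^ #E * ((2 ^ B + 1) ^ (#E * r)) ^ t` states after `t` rounds. -/
theorem Algorithm.card_states_le (A : Algorithm n B Ω) {ι : Type*} [Fintype ι]
    (H : ι → Hypergraph (Fin n)) (ω : Ω) (v : Fin n) (E : Finset (Set (Fin n))) (r : ℕ)
    (hE : ∀ c, ∀ e ∈ (H c).edgeSet, v ∈ e → e ∈ E) (hr : ∀ e ∈ E, e.ncard ≤ r) (t : ℕ) :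
    #(univ.image fun c => A.states (H c) ω t v) ≤
      2 ^ #E * ((2 ^ B + 1) ^ (#E * r)) ^ t := by
  induction t with
  | zero =>
    have : (univ.image fun c => A.states (H c) ω 0 v) ⊆
        E.powerset.image fun s : Finset (Set (Fin n)) => A.init v {e | e ∈ s} ω := by
      intro σ hσ
      obtain ⟨c, -, rfl⟩ := mem_image.1 hσ
      refine mem_image.2 ⟨{e ∈ E | e ∈ incident (H c) v}, mem_powerset.2 (filter_subset _ _), ?_⟩
      rw [Algorithm.states]
      congr 1
      ext e
      simp only [mem_filter, Set.mem_ofPred_eq, and_iff_right_iff_imp]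
      exact fun he => hE c e he.1 he.2
    rw [pow_zero, mul_one, ← card_powerset]
    exact (card_le_card this).trans card_image_le
  | succ t ih =>
    -- Pairs of an edge and a possible sender: nothing arrives at `v` from elsewhere.
    let Q : Finset (Σ _ : Set (Fin n), Fin n) := E.sigma fun e => e.toFinset
    have hQ : #Q ≤ #E * r := by
      rw [card_sigma]
      refine (sum_le_card_nsmul _ _ r fun e he => ?_).trans (by simp)
      rw [← Set.ncard_eq_toFinset_card']
      exact hr e he
    let F : Finset (Set (Fin n) → Fin n → Option (Msg B)) :=
      univ.image fun c => fun e x => A.traffic (H c) (A.states (H c) ω t) e x v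
    have hF : #F ≤ (2 ^ B + 1) ^ (#E * r) := by
      have h := card_le_of_support Q F (by
        intro g hg e x hex
        obtain ⟨c, -, rfl⟩ := mem_image.1 hg
        refine if_neg fun h => hex ?_
        simp only [Q, mem_sigma, Set.mem_toFinset]
        exact ⟨hE c e h.1 h.2.2.1, h.2.1⟩)
      refine h.trans ?_
      simp only [Fintype.card_pi, Fintype.card_bool, prod_const, card_univ, Fintype.card_fin]
      exact Nat.pow_le_pow_right (by positivity) hQ
    have hsub : (univ.image fun c => A.states (H c) ω (t + 1) v) ⊆
        image₂ A.receive (univ.image fun c => A.states (H c) ω t v) F := by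
      intro σ hσ
      obtain ⟨c, -, rfl⟩ := mem_image.1 hσ
      exact mem_image₂_of_mem (mem_image_of_mem (fun c => A.states (H c) ω t v) (mem_univ c))
        (mem_image_of_mem _ (mem_univ c))
    calc _ ≤ _ := card_le_card hsub
      _ ≤ _ := card_image₂_le ..
      _ ≤ _ := Nat.mul_le_mul ih hF
      _ = _ := by ring

/-! ### The hard family of hypergraphs -/

/-- A slot `(τ, a, b)` stands for a potential edge between element `a` of the core part `τ` and
element `b` of the core part `τ + 1`. -/
abbrev Slot (m : ℕ) : Type := Fin 3 × Fin m × Fin m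

/-- The vertices are arranged in parts of `m` elements each, indexed by `P`; three of the parts
form the core. -/
structure Layout (n m : ℕ) (P : Type) where
  vertex : P × Fin m ↪ Fin n
  core : Fin 3 ↪ P

namespace Layout

variable {n m : ℕ} {P : Type} [DecidableEq P] (L : Layout n m P)

/-- The element of part `j` that belongs to the potential edge of the slot `q`. -/
def coord (q : Slot m) (j : P) : Fin m :=
  -- The sum is modulo `m`: any two of `a`, `b`, `a + b` determine the third, which keeps degrees
  -- linear in `m` outside the core too.
  if j = L.core q.1 then q.2.1 else if j = L.core (q.1 + 1) then q.2.2 else q.2.1 + q.2.2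

/-- The potential edge of a slot has one vertex in each part except one part of the core. -/
def hyperedge (q : Slot m) : Set (Fin n) :=
  (fun j => L.vertex (j, L.coord q j)) '' {j | j ≠ L.core (q.1 + 2)}

/-- The hypergraph formed by the potential edges selected by `c`. -/
def graph (c : Slot m → Bool) : Hypergraph (Fin n) where
  vertexSet := Set.univ
  edgeSet := L.hyperedge '' {q | c q = true}
  subset_vertexSet_of_mem_edgeSet' := fun _ _ => Set.subset_univ _

theorem vertex_mem_hyperedge {q : Slot m} {j : P} {i : Fin m} :
    L.vertex (j, i) ∈ L.hyperedge q ↔ j ≠ L.core (q.1 + 2) ∧ L.coord q j = i := by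
  simp only [hyperedge, Set.mem_image, Set.mem_ofPred_eq, EmbeddingLike.apply_eq_iff_eq,
    Prod.mk.injEq]
  exact ⟨fun ⟨k, hk, h1, h2⟩ => h1 ▸ ⟨hk, h2⟩, fun h => ⟨j, h.1, rfl, h.2⟩⟩

theorem coord_core (q : Slot m) : L.coord q (L.core q.1) = q.2.1 := by simp [coord]

theorem coord_core_succ (q : Slot m) : L.coord q (L.core (q.1 + 1)) = q.2.2 := by
  simp [coord]

/-- The omitted core part reveals `τ`; the vertices in the other two core parts reveal `a` and `b`.
-/
theorem hyperedge_injective : Function.Injective L.hyperedge := by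
  intro q q' h
  have key : ∀ j i, (j ≠ L.core (q.1 + 2) ∧ L.coord q j = i) ↔
      (j ≠ L.core (q'.1 + 2) ∧ L.coord q' j = i) := by
    intro j i
    rw [← vertex_mem_hyperedge, ← vertex_mem_hyperedge, h]
  have h1 : q.1 = q'.1 := by
    by_contra hne
    have := (key (L.core (q.1 + 2)) (L.coord q' (L.core (q.1 + 2)))).2
      ⟨by simpa using hne, rfl⟩
    exact this.1 rfl
  have h2 := ((key (L.core q.1) _).1 ⟨by simp, rfl⟩).2
  have h3 := ((key (L.core (q.1 + 1)) _).1 ⟨by simp, rfl⟩).2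
  rw [coord_core, h1, coord_core] at h2
  rw [coord_core_succ, h1, coord_core_succ] at h3
  exact Prod.ext h1 (Prod.ext h2.symm h3.symm)

theorem hyperedge_mem_graph {c : Slot m → Bool} {q : Slot m} :
    L.hyperedge q ∈ (L.graph c).edgeSet ↔ c q = true := by
  simp [graph, L.hyperedge_injective.eq_iff]

theorem ncard_hyperedge [Fintype P] (q : Slot m) :
    (L.hyperedge q).ncard = Fintype.card P - 1 := by
  rw [hyperedge, Set.ncard_image_of_injective]
  · rw [show {j | j ≠ L.core (q.1 + 2)} = ({L.core (q.1 + 2)} : Set P)ᶜ from rfl,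
      Set.ncard_compl, Set.ncard_singleton, Nat.card_eq_fintype_card]
  · intro j j' h
    exact congrArg Prod.fst (L.vertex.injective h)

theorem graph_isUniform [Fintype P] (c : Slot m → Bool) :
    IsUniform (Fintype.card P - 1) (L.graph c) := by
  refine ⟨rfl, ?_⟩
  rintro _ ⟨q, -, rfl⟩
  exact L.ncard_hyperedge q

open Classical in
/-- Every vertex belongs to at most `3 * m` potential edges. -/
theorem card_slots_le (v : Fin n) : #{q : Slot m | v ∈ L.hyperedge q} ≤ 3 * m := by
  by_cases hv : ∃ z, L.vertex z = v
  · obtain ⟨⟨j, i⟩, rfl⟩ := hv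
    have := card_le_card_of_injOn (s := {q : Slot m | L.vertex (j, i) ∈ L.hyperedge q})
      (t := (univ : Finset (Fin 3 × Fin m)))
      -- Given `τ` and one of `a`, `b`, the position of the vertex in its part fixes the other.
      (fun q => if j = L.core q.1 then (q.1, q.2.2) else (q.1, q.2.1)) (fun _ _ => by simp) (by
        rintro ⟨τ, a, b⟩ h ⟨τ', a', b'⟩ h' heq
        simp only [coe_filter, mem_univ, true_and, Set.mem_ofPred_eq, vertex_mem_hyperedge] at h h'
        have hτ : τ = τ' := by
          dsimp only at heq
          split_ifs at heq <;> exact (Prod.mk.inj heq).1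
        subst hτ
        have hc := h.2.trans h'.2.symm
        have : NeZero m := ⟨fun h0 => by subst h0; exact a.elim0⟩
        by_cases h1 : j = L.core τ
        · simp only [h1, if_true, Prod.mk.injEq, true_and] at heq
          simp only [coord, h1, if_true] at hc
          rw [heq, hc]
        · simp only [h1, if_false, Prod.mk.injEq, true_and] at heq
          subst heq
          by_cases h2 : j = L.core (τ + 1)
          · rw [h2, coord_core_succ, coord_core_succ] at hc
            exact congrArg (fun b => (τ, a, b)) hc
          · simp only [coord, h1, h2, if_false, add_right_inj] at hc
            rw [hc])
    simpa using this
  · rw [filter_false_of_mem]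
    · simp
    · rintro q - ⟨j, -, h⟩
      exact hv ⟨_, h⟩

/-! ### Core triangles -/

/-- The closed path through one element of each part of the core. -/
def coreCycle (x : Fin 3 → Fin m) : ThreeCycle n where
  vert i := L.vertex (L.core i, x i)
  edge i := L.hyperedge (i, x i, x (i + 1))

/-- Each edge omits the core part of the opposite vertex, so the cycle is induced and one family
serves all three kinds. -/
theorem coreCycle_isTriangle {c : Slot m → Bool} {x : Fin 3 → Fin m}
    (h : ∀ i, c (i, x i, x (i + 1)) = true) (kind : TriangleKind) :
    (L.coreCycle x).IsTriangle (L.graph c) kind := by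
  have h1 : (L.coreCycle x).IsClosedPath (L.graph c) := by
    refine fun i => ⟨L.hyperedge_mem_graph.2 (h i), ?_, ?_⟩
    · exact L.vertex_mem_hyperedge.2 ⟨by simp, L.coord_core _⟩
    · exact L.vertex_mem_hyperedge.2 ⟨by simp, L.coord_core_succ _⟩
  have h2 : (L.coreCycle x).IsSimple := by
    constructor
    · intro i j hij
      exact L.core.injective (congrArg Prod.fst (L.vertex.injective hij))
    · intro i j hij
      exact congrArg Prod.fst (L.hyperedge_injective hij)
  have h3 : (L.coreCycle x).IsInduced := by
    refine ⟨h2, fun i hi => (L.vertex_mem_hyperedge.1 hi).1 ?_⟩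
    change L.core i = L.core (i + 1 + 2)
    rw [add_assoc, show (1 + 2 : Fin 3) = 0 from rfl, add_zero]
  cases kind
  exacts [h1, ⟨h1, h2⟩, ⟨h1, h3⟩]

end Layout

theorem ThreeCycle.IsTriangle.isClosedPath {n : ℕ} {H : Hypergraph (Fin n)} {t : ThreeCycle n}
    {kind : TriangleKind} (h : t.IsTriangle H kind) : t.IsClosedPath H := by
  cases kind
  exacts [h, h.1, h.1]

/-- Correctness constrains the sequence actually output; this transfers it to the equivalent core
cycle. -/
theorem ThreeCycle.Same.edge_mem {n : ℕ} {s t : ThreeCycle n} (h : s.Same t) {E : Set (Set (Fin n))}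
    (hs : ∀ i, s.edge i ∈ E) (i : Fin 3) : t.edge i ∈ E := by
  obtain ⟨k, h | h⟩ := h
  · have := (h (i - k)).2
    rw [sub_add_cancel] at this
    exact this ▸ hs _
  · have := (h (k - i - 1)).2
    rw [show k - (k - i - 1) - 1 = i by abel] at this
    exact this ▸ hs _

namespace Layout

variable {n m : ℕ} {P : Type} [DecidableEq P] (L : Layout n m P)

/-- The core triangles, given by their vertices, that are present in `L.graph c`. -/
def triangles (c : Slot m → Bool) : Finset (Fin 3 → Fin m) :=
  {x | ∀ i, c (i, x i, x (i + 1)) = true}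

open Classical in
/-- The core triangles that are described by a member of the output `S`. -/
noncomputable def found (S : Set (ThreeCycle n)) : Finset (Fin 3 → Fin m) :=
  {x | ∃ s ∈ S, s.Same (L.coreCycle x)}

open Classical in
/-- The slots of the edges of the core triangles described by members of the output `S`. -/
noncomputable def slots (S : Set (ThreeCycle n)) : Finset (Slot m) :=
  (L.found S).biUnion fun x => univ.image fun i => (i, x i, x (i + 1))

theorem mem_slots {S : Set (ThreeCycle n)} {x : Fin 3 → Fin m} (hx : x ∈ L.found S) (i : Fin 3) :
    (i, x i, x (i + 1)) ∈ L.slots S :=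
  mem_biUnion.2 ⟨x, hx, mem_image.2 ⟨i, mem_univ _, rfl⟩⟩

/-- The three coordinate projections of the found triples embed into the slots of index 0, 1 and 2.
-/
theorem card_found_sq_le (S : Set (ThreeCycle n)) :
    #(L.found S) ^ 2 ≤ #(L.slots S) ^ 3 := by
  classical
  refine card_sq_le_cube_of_projections _
    (fun i => {p : Fin m × Fin m | (i, p) ∈ L.slots S}) (fun x hx i => ?_) _ fun i => ?_
  · simpa using L.mem_slots hx i
  · exact card_le_card_of_injOn (fun p => (i, p)) (fun p hp => by simpa using hp)
      (fun p _ p' _ h => (Prod.mk.inj h).2)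

/-- The edges of the triangles that are output in a correct enumeration are present. -/
theorem slots_present {c : Slot m → Bool} {kind : TriangleKind} {S : Fin n → Set (ThreeCycle n)}
    (h : IsEnumeration kind (L.graph c) S) (v : Fin n) : ∀ q ∈ L.slots (S v), c q = true := by
  classical
  intro q hq
  obtain ⟨x, hx, hq⟩ := mem_biUnion.1 hq
  obtain ⟨i, -, rfl⟩ := mem_image.1 hq
  obtain ⟨s, hs, hsame⟩ := (mem_filter.1 hx).2
  refine L.hyperedge_mem_graph.1 ?_
  exact hsame.edge_mem (fun j => ((h.1 v s hs).isClosedPath j).1) i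

/-- In a correct enumeration all core triangles are found. -/
theorem card_triangles_le {c : Slot m → Bool} {kind : TriangleKind}
    {S : Fin n → Set (ThreeCycle n)} (h : IsEnumeration kind (L.graph c) S) :
    #(triangles c) ≤ ∑ v, #(L.found (S v)) := by
  classical
  refine (card_le_card fun x hx => ?_).trans card_biUnion_le
  obtain ⟨v, ⟨s, hs⟩, -⟩ := h.2 (L.coreCycle x)
    (L.coreCycle_isTriangle (by simpa [triangles] using hx) kind)
  exact mem_biUnion.2 ⟨v, mem_univ _, by simpa [found] using ⟨s, hs⟩⟩

/-- On average, one eighth of the core triangles is present. -/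
theorem sum_card_triangles (m : ℕ) :
    (∑ c : Slot m → Bool, #(triangles c)) * 8 = m ^ 3 * 2 ^ Fintype.card (Slot m) := by
  classical
  have h : ∀ x : Fin 3 → Fin m,
      #{c : Slot m → Bool | ∀ i, c (i, x i, x (i + 1)) = true} * 8 =
        2 ^ Fintype.card (Slot m) := by
    intro x
    -- Three distinct slots must be selected, hence the factor `2 ^ 3`.
    have hinj : Function.Injective fun i : Fin 3 => ((i, x i, x (i + 1)) : Slot m) :=
      fun i j hij => (Prod.mk.inj hij).1
    have := card_true_on_mul (univ.image fun i : Fin 3 => ((i, x i, x (i + 1)) : Slot m))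
    rw [card_image_of_injective _ hinj] at this
    simpa using this
  have hswap : ∑ c : Slot m → Bool, #(triangles c) =
      ∑ x : Fin 3 → Fin m, #{c : Slot m → Bool | ∀ i, c (i, x i, x (i + 1)) = true} := by
    simp only [triangles, card_filter]
    exact sum_comm
  rw [hswap, sum_mul, sum_congr rfl fun x _ => h x]
  simp

/-- At least one sixteenth of all selections contain at least half the average number of core
triangles. -/
theorem card_many_triangles {m : ℕ} (hm : 0 < m) :
    2 ^ Fintype.card (Slot m) ≤ #{c : Slot m → Bool | m ^ 3 ≤ 16 * #(triangles c)} * 16 := by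
  set N := 2 ^ Fintype.card (Slot m) with hN
  set G : Finset (Slot m → Bool) := {c | m ^ 3 ≤ 16 * #(triangles c)} with hG
  have hcard : #(univ : Finset (Slot m → Bool)) = N := by simp [hN]
  have hsum := sum_card_triangles m
  rw [← hN] at hsum
  -- Reverse Markov: the left side is `2 * m ^ 3 * N`, so the excess over `m ^ 3 * N` must come from
  -- `G`.
  have hle : ∑ c : Slot m → Bool, 16 * #(triangles c) ≤
      ∑ c : Slot m → Bool, (m ^ 3 + if c ∈ G then 16 * m ^ 3 else 0) := by
    refine sum_le_sum fun c _ => ?_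
    by_cases hc : c ∈ G
    · have : #(triangles c) ≤ m ^ 3 := (card_le_univ _).trans (by simp)
      simp only [hc, if_true]
      omega
    · simp only [hc, if_false]
      simp only [hG, mem_filter, mem_univ, true_and, not_le] at hc
      omega
  rw [← mul_sum, sum_add_distrib, sum_const, hcard, ← sum_filter, sum_const,
    filter_mem_eq_inter, univ_inter, smul_eq_mul, smul_eq_mul] at hle
  have h3 : 0 < m ^ 3 := by positivity
  refine le_of_mul_le_mul_left ?_ h3
  linarith

end Layout

/-! ### The communication bound for fixed coins -/

namespace Layout

variable {n m : ℕ} {P : Type} [DecidableEq P] [Fintype P] (L : Layout n m P)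
  {B : ℕ} {Ω : Type u}

open Classical in
/-- On the inputs `L.graph c`, a vertex can be in few states after `T` rounds. -/
theorem card_states_le (A : Algorithm n B Ω) (ω : Ω) (v : Fin n) (T : ℕ) :
    #(univ.image fun c => A.states (L.graph c) ω T v) ≤
      2 ^ (3 * m + (B + 1) * (3 * m * (Fintype.card P - 1)) * T) := by
  have hE : #(({q : Slot m | v ∈ L.hyperedge q} : Finset (Slot m)).image L.hyperedge) ≤ 3 * m :=
    card_image_le.trans (L.card_slots_le v)
  have h := A.card_states_le L.graph ω v
    (({q : Slot m | v ∈ L.hyperedge q} : Finset (Slot m)).image L.hyperedge)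
    (Fintype.card P - 1) (by
      rintro c _ ⟨q, -, rfl⟩ hv
      exact mem_image_of_mem _ (by simpa using hv)) (by
      intro e he
      obtain ⟨q, -, rfl⟩ := mem_image.1 he
      exact (L.ncard_hyperedge q).le) T
  have hB : 2 ^ B + 1 ≤ 2 ^ (B + 1) := by
    have := Nat.one_le_two_pow (n := B)
    rw [pow_succ]
    omega
  refine h.trans ?_
  rw [pow_add, pow_mul 2 _ T, pow_mul 2 (B + 1)]
  refine Nat.mul_le_mul (Nat.pow_le_pow_right two_pos hE) (Nat.pow_le_pow_left ?_ T)
  exact (Nat.pow_le_pow_left hB _).trans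
    (Nat.pow_le_pow_right (by positivity) (Nat.mul_le_mul_right _ hE))

open Classical in
/-- Few inputs are solved in such a way that the vertex `v` finds many core triangles, if these
have more than `X` edges. -/
theorem card_solved_by_le (A : Algorithm n B Ω) (kind : TriangleKind) (ω : Ω) (T s X : ℕ)
    (hX : ∀ S : Set (ThreeCycle n), s ≤ #(L.found S) → X ≤ #(L.slots S)) (v : Fin n) :
    #{c | A.Solves kind T (L.graph c) ω ∧
        s ≤ #(L.found (A.output (A.states (L.graph c) ω T v)))} * 2 ^ X ≤
      2 ^ Fintype.card (Slot m) *
        2 ^ (3 * m + (B + 1) * (3 * m * (Fintype.card P - 1)) * T) := by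
  set G : Finset (Slot m → Bool) := {c | A.Solves kind T (L.graph c) ω ∧
    s ≤ #(L.found (A.output (A.states (L.graph c) ω T v)))} with hG
  -- All inputs in the fibre share the output of `σ`, so they all contain the same set of at least
  -- `X` slots.
  have hfib : ∀ σ ∈ G.image fun c => A.states (L.graph c) ω T v,
      #{c ∈ G | A.states (L.graph c) ω T v = σ} ≤ 2 ^ Fintype.card (Slot m) / 2 ^ X := by
    intro σ hσ
    rw [Nat.le_div_iff_mul_le (by positivity)]
    have hle : X ≤ #(L.slots (A.output σ)) := by
      obtain ⟨c, hc, rfl⟩ := mem_image.1 hσ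
      exact hX _ (mem_filter.1 hc).2.2
    rw [← card_true_on_mul (L.slots (A.output σ))]
    refine Nat.mul_le_mul (card_le_card fun c hc => ?_) (Nat.pow_le_pow_right two_pos hle)
    obtain ⟨hcG, rfl⟩ := mem_filter.1 hc
    have hsol : A.Solves kind T (L.graph c) ω := (mem_filter.1 hcG).2.1
    exact mem_filter.2 ⟨mem_univ _, L.slots_present hsol v⟩
  calc #G * 2 ^ X
      ≤ 2 ^ Fintype.card (Slot m) / 2 ^ X *
          #(G.image fun c => A.states (L.graph c) ω T v) * 2 ^ X :=
        Nat.mul_le_mul_right _ (card_le_mul_card_image G _ hfib)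
    _ = 2 ^ Fintype.card (Slot m) / 2 ^ X * 2 ^ X *
          #(G.image fun c => A.states (L.graph c) ω T v) := by ring
    _ ≤ 2 ^ Fintype.card (Slot m) * #(univ.image fun c => A.states (L.graph c) ω T v) :=
        Nat.mul_le_mul (Nat.div_mul_le_self _ _) (card_le_card (image_subset_image (subset_univ _)))
    _ ≤ _ := Nat.mul_le_mul_left _ (L.card_states_le A ω v T)

open Classical in
/-- If an algorithm, with fixed coins, solves the task on most of the inputs `L.graph c`, then some
vertex has to learn the edges of many core triangles. -/
theorem exists_learned (A : Algorithm n B Ω) (kind : TriangleKind) (ω : Ω) (T : ℕ) (hm : 0 < m)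
    (hsolve : 31 * 2 ^ Fintype.card (Slot m) ≤ 32 * #{c | A.Solves kind T (L.graph c) ω}) :
    ∃ k s, m ^ 3 ≤ 16 * n * s ∧ s ^ 2 ≤ k ^ 3 ∧
      k ≤ 5 + n + (3 * m + (B + 1) * (3 * m * (Fintype.card P - 1)) * T) := by
  set R := 3 * m + (B + 1) * (3 * m * (Fintype.card P - 1)) * T with hR
  set N := 2 ^ Fintype.card (Slot m) with hN
  have hN0 : 0 < N := by positivity
  have hn : 0 < n := (L.vertex (L.core 0, ⟨0, hm⟩)).pos
  by_contra! hcon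
  set good : Fin n → Finset (Slot m → Bool) := fun v => {c | A.Solves kind T (L.graph c) ω ∧
    m ^ 3 ⌈/⌉ (16 * n) ≤ #(L.found (A.output (A.states (L.graph c) ω T v)))} with hgood
  have hceil : ∀ s, m ^ 3 ⌈/⌉ (16 * n) ≤ s ↔ m ^ 3 ≤ 16 * n * s := fun s => by
    rw [ceilDiv_le_iff_le_smul (by positivity), smul_eq_mul]
  have hv : ∀ v, #(good v) * 2 ^ (5 + n + R + 1) ≤ N * 2 ^ R := fun v =>
    L.card_solved_by_le A kind ω T _ _
      (fun S hS => hcon _ _ ((hceil _).1 hS) (L.card_found_sq_le S)) v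
  set G₁ : Finset (Slot m → Bool) := {c | A.Solves kind T (L.graph c) ω}
  set G₂ : Finset (Slot m → Bool) := {c | m ^ 3 ≤ 16 * #(triangles c)}
  -- Pigeonhole: if every vertex stayed below the threshold, too few core triangles would be found.
  have hcover : G₁ ∩ G₂ ⊆ univ.biUnion good := by
    intro c hc
    obtain ⟨h1, h2⟩ := mem_inter.1 hc
    have h1 := (mem_filter.1 h1).2
    have h2 := (mem_filter.1 h2).2
    by_contra hnot
    simp only [mem_biUnion, mem_univ, true_and, hgood, mem_filter, h1, not_exists, hceil,
      not_le] at hnot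
    have hlt := sum_lt_sum_of_nonempty (s := (univ : Finset (Fin n))) ⟨⟨0, hn⟩, mem_univ _⟩
      fun v _ => hnot v
    rw [← mul_sum, sum_const, card_univ, Fintype.card_fin, smul_eq_mul] at hlt
    have := L.card_triangles_le h1
    have : n * (16 * #(triangles c)) ≤ n * (16 * ∑ v,
      #(L.found (A.output (A.states (L.graph c) ω T v)))) := by gcongr
    have : n * m ^ 3 ≤ n * (16 * #(triangles c)) := by gcongr
    linarith
  -- 31/32 + 1/16 - 1 = 1/32.
  have hinter : N ≤ #(G₁ ∩ G₂) * 32 := by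
    have h1 := card_union_add_card_inter G₁ G₂
    have h2 : #(G₁ ∪ G₂) ≤ N := (card_le_univ _).trans (by simp [hN])
    have h3 : N ≤ #G₂ * 16 := card_many_triangles hm
    omega
  have hsum : #(G₁ ∩ G₂) * 2 ^ (5 + n + R + 1) ≤ n * (N * 2 ^ R) :=
    calc _ ≤ (∑ v, #(good v)) * 2 ^ (5 + n + R + 1) :=
          Nat.mul_le_mul_right _ ((card_le_card hcover).trans card_biUnion_le)
      _ ≤ _ := by
          rw [sum_mul]
          exact (sum_le_sum fun v _ => hv v).trans (by simp)
  have hn2 : n < 2 ^ n := Nat.lt_two_pow_self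
  -- The 5 pays for the factor 32, and `n` for the union bound over vertices via `n < 2 ^ n`.
  have : N * 2 ^ (5 + n + R + 1) ≤ N * (2 ^ (5 + n + R)) :=
    calc N * 2 ^ (5 + n + R + 1) ≤ #(G₁ ∩ G₂) * 32 * 2 ^ (5 + n + R + 1) := by gcongr
      _ = 32 * (#(G₁ ∩ G₂) * 2 ^ (5 + n + R + 1)) := by ring
      _ ≤ 32 * (n * (N * 2 ^ R)) := by gcongr
      _ ≤ 32 * (2 ^ n * (N * 2 ^ R)) := by gcongr
      _ = N * (2 ^ (5 + n + R)) := by rw [pow_add, pow_add]; ring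
  have := Nat.le_of_mul_le_mul_left this hN0
  exact absurd this (not_le.2 (Nat.pow_lt_pow_right one_lt_two (Nat.lt_succ_self _)))

end Layout

/-! ### Random inputs -/

namespace Layout

variable {n m : ℕ} {P : Type} [DecidableEq P] (L : Layout n m P) {B : ℕ} {Ω : Type u}

/-- The random hypergraph in which each potential edge is present with probability `1/2`,
independently. -/
noncomputable def randomGraph : PMF (Hypergraph (Fin n)) :=
  (PMF.uniformOfFintype (Slot m → Bool)).map L.graph

theorem isUniform_of_mem_support [Fintype P] {H : Hypergraph (Fin n)} (hH : H ∈ L.randomGraph.support) :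
    IsUniform (Fintype.card P - 1) H := by
  rw [randomGraph, PMF.support_map] at hH
  obtain ⟨c, -, rfl⟩ := hH
  exact L.graph_isUniform c

open Classical in
/-- Averaging over the coins: for some outcome of the coins, the algorithm succeeds on a large
fraction of the inputs. -/
theorem exists_coins [MeasurableSpace Ω] (μ : MeasureTheory.Measure Ω)
    [MeasureTheory.IsProbabilityMeasure μ] (A : Algorithm n B Ω) (kind : TriangleKind) (T : ℕ)
    (hmeas : ∀ c, MeasurableSet {ω | A.Solves kind T (L.graph c) ω})
    (h : ENNReal.ofReal (31 / 32) ≤ A.successProb kind T L.randomGraph μ) :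
    ∃ ω, 31 * 2 ^ Fintype.card (Slot m) ≤ 32 * #{c | A.Solves kind T (L.graph c) ω} := by
  -- Interchanging input and coins makes the success probability the mean over coins of the solved
  -- fraction.
  have hsucc : A.successProb kind T L.randomGraph μ =
      (2 ^ Fintype.card (Slot m) : ENNReal)⁻¹ *
        ∫⁻ ω, (#{c | A.Solves kind T (L.graph c) ω} : ENNReal) ∂μ := by
    have hint : ∫⁻ ω, (#{c | A.Solves kind T (L.graph c) ω} : ENNReal) ∂μ =
        ∑ c, μ {ω | A.Solves kind T (L.graph c) ω} := by
      have : ∀ ω, (#{c | A.Solves kind T (L.graph c) ω} : ENNReal) =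
          ∑ c, Set.indicator {ω | A.Solves kind T (L.graph c) ω} 1 ω := by
        intro ω
        rw [card_filter, Nat.cast_sum]
        refine sum_congr rfl fun c _ => ?_
        simp only [Set.indicator_apply, Set.mem_ofPred_eq, Pi.one_apply, Nat.cast_ite,
          Nat.cast_one, Nat.cast_zero]
      simp_rw [this]
      rw [MeasureTheory.lintegral_finsetSum _ fun c _ => measurable_one.indicator (hmeas c)]
      exact sum_congr rfl fun c _ => MeasureTheory.lintegral_indicator_one (hmeas c)
    rw [hint, Algorithm.successProb]
    simp only [randomGraph, PMF.map_apply, ← ENNReal.tsum_mul_right]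
    rw [ENNReal.tsum_comm, tsum_fintype, mul_sum]
    refine sum_congr rfl fun c _ => ?_
    rw [tsum_eq_single (L.graph c) (fun H hH => by simp [hH])]
    simp
  have hfin : ∫⁻ ω, (#{c | A.Solves kind T (L.graph c) ω} : ENNReal) ∂μ ≠ ⊤ := by
    refine ne_top_of_le_ne_top (b := (2 ^ Fintype.card (Slot m) : ENNReal)) (by simp) ?_
    refine (MeasureTheory.lintegral_mono (g := fun _ => 2 ^ Fintype.card (Slot m))
      fun ω => ?_).trans (by simp)
    have hle : #{c | A.Solves kind T (L.graph c) ω} ≤ 2 ^ Fintype.card (Slot m) :=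
      (card_le_univ _).trans (by simp)
    change (_ : ENNReal) ≤ 2 ^ _
    exact_mod_cast hle
  obtain ⟨ω, hω⟩ := MeasureTheory.exists_lintegral_le hfin
  refine ⟨ω, ?_⟩
  have h1 : ENNReal.ofReal (31 / 32) ≤ (2 ^ Fintype.card (Slot m) : ENNReal)⁻¹ *
      (#{c | A.Solves kind T (L.graph c) ω} : ENNReal) :=
    h.trans (hsucc.le.trans (by gcongr))
  have h2 := ENNReal.toReal_mono (by finiteness) h1
  rw [ENNReal.toReal_ofReal (by norm_num), ENNReal.toReal_mul, ENNReal.toReal_inv,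
    ENNReal.toReal_pow, ENNReal.toReal_natCast, ENNReal.toReal_ofNat, inv_mul_eq_div,
    div_le_div_iff₀ (by norm_num) (by positivity)] at h2
  rw [mul_comm 32]
  exact_mod_cast h2

end Layout

/-- The layout with `r + 1` parts of `n / (r + 1)` vertices each. -/
def evenLayout (r n : ℕ) (hr : 2 ≤ r) : Layout n (n / (r + 1)) (Fin (r + 1)) where
  vertex := finProdFinEquiv.toEmbedding.trans (Fin.castLEEmb (Nat.mul_div_le n (r + 1)))
  core := Fin.castLEEmb (by omega)

/-- The growth rate that follows from `Layout.exists_learned`. -/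
theorem rounds_lower_bound {r n m B T k s : ℕ} (hm : 0 < m) (hn : n ≤ 2 * (r + 1) * m)
    (h1 : m ^ 3 ≤ 16 * n * s) (h2 : s ^ 2 ≤ k ^ 3)
    (h3 : k ≤ 5 + n + (3 * m + (B + 1) * (3 * m * r) * T)) :
    n ≤ (2 * (r + 1) * (32 * (r + 1)) ^ 2 * (2 * r + 10 + 3 * r * ((B + 1) * T))) ^ 3 := by
  set Y := 2 * r + 10 + 3 * r * ((B + 1) * T) with hY
  -- As `m ≥ 1`, the terms `5`, `n` and `3 * m` are at most `5 * m`, `(2 * r + 2) * m` and `3 * m`.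
  have hk : k ≤ m * Y := by
    rw [hY]
    nlinarith
  have h4 : m ^ 2 ≤ 32 * (r + 1) * s := by
    refine le_of_mul_le_mul_left (a := m) ?_ hm
    calc m * m ^ 2 = m ^ 3 := by ring
      _ ≤ 16 * n * s := h1
      _ ≤ 16 * (2 * (r + 1) * m) * s := by gcongr
      _ = m * (32 * (r + 1) * s) := by ring
  have h5 : m ≤ (32 * (r + 1)) ^ 2 * Y ^ 3 := by
    refine le_of_mul_le_mul_left (a := m ^ 3) ?_ (by positivity)
    calc m ^ 3 * m = (m ^ 2) ^ 2 := by ring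
      _ ≤ (32 * (r + 1) * s) ^ 2 := by gcongr
      _ = (32 * (r + 1)) ^ 2 * s ^ 2 := by ring
      _ ≤ (32 * (r + 1)) ^ 2 * (m * Y) ^ 3 := by
        exact Nat.mul_le_mul_left _ (h2.trans (Nat.pow_le_pow_left hk 3))
      _ = m ^ 3 * ((32 * (r + 1)) ^ 2 * Y ^ 3) := by ring
  calc n ≤ 2 * (r + 1) * m := hn
    _ ≤ 2 * (r + 1) * ((32 * (r + 1)) ^ 2 * Y ^ 3) := by gcongr
    _ = (2 * (r + 1) * (32 * (r + 1)) ^ 2) * Y ^ 3 := by ring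
    -- The constant is wastefully cubed so that the cube root becomes exact.
    _ ≤ (2 * (r + 1) * (32 * (r + 1)) ^ 2) ^ 3 * Y ^ 3 := by
      gcongr
      exact Nat.le_self_pow (by norm_num) _
    _ = _ := by ring

end HyperCongest

theorem corollary3p3 (r : ℕ) (hr : 2 ≤ r) :
    ∃ p : ℝ, 0 < p ∧ p < 1 ∧
    ∃ D : (n : ℕ) → PMF (Hypergraph (Fin n)),
      (∀ n, ∀ H ∈ (D n).support, HyperCongest.IsUniform r H) ∧
      ∀ K : ℝ, ∃ c : ℝ, 0 < c ∧ ∃ N : ℕ, ∀ n : ℕ, N ≤ n →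
        ∀ B : ℕ, (B : ℝ) ≤ K * Real.log n →
        ∀ (M : HyperCongest.Model) (kind : HyperCongest.TriangleKind)
          (Ω : Type u) [MeasurableSpace Ω] (μ : MeasureTheory.Measure Ω)
          [MeasureTheory.IsProbabilityMeasure μ]
          (A : HyperCongest.Algorithm n B Ω) (T : ℕ),
          A.Obeys M r T →
          (∀ H : Hypergraph (Fin n), HyperCongest.IsUniform r H →
            MeasurableSet {ω | A.Solves kind T H ω}) →
          ENNReal.ofReal p ≤ A.successProb kind T (D n) μ →
          c * ((n : ℝ) ^ ((1 : ℝ) / 3) / Real.log n) ≤ T := by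
  have huniform : ∀ n, ∀ H ∈ (HyperCongest.evenLayout r n hr).randomGraph.support,
      HyperCongest.IsUniform r H := fun n H hH => by
    simpa using (HyperCongest.evenLayout r n hr).isUniform_of_mem_support hH
  refine ⟨31 / 32, by norm_num, by norm_num,
    fun n => (HyperCongest.evenLayout r n hr).randomGraph, huniform, fun K => ?_⟩
  obtain ⟨Q, hQ⟩ : ∃ Q : ℕ, Q = 2 * (r + 1) * (32 * (r + 1)) ^ 2 := ⟨_, rfl⟩
  have hQ0 : 0 < Q := by rw [hQ]; positivity
  refine ⟨1 / (2 * Q * (3 * r) * (|K| + 1)), by positivity,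
    -- The cube makes `Q * (2 * r + 10)` at most half of `n ^ (1/3)`, to be absorbed; the other term
    -- gives `m > 0` and `log n ≥ 1`.
    (2 * Q * (2 * r + 10)) ^ 3 + 3 * (r + 1), ?_⟩
  intro n hn B hB M kind Ω _ μ _ A T _ hmeas hp
  have hnr : 3 * (r + 1) ≤ n := le_trans (Nat.le_add_left _ _) hn
  have hm : 0 < n / (r + 1) := Nat.div_pos (by omega) (by omega)
  have hnm : n ≤ 2 * (r + 1) * (n / (r + 1)) := by
    have h1 := Nat.div_add_mod n (r + 1)
    have h2 := Nat.mod_lt n (Nat.succ_pos r)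
    nlinarith
  obtain ⟨ω, hω⟩ := (HyperCongest.evenLayout r n hr).exists_coins μ A kind T
    (fun c => hmeas _ (by simpa using (HyperCongest.evenLayout r n hr).graph_isUniform c)) hp
  obtain ⟨k, s, h1, h2, h3⟩ := (HyperCongest.evenLayout r n hr).exists_learned A kind ω T hm hω
  rw [Fintype.card_fin, Nat.add_sub_cancel] at h3
  have hbound := HyperCongest.rounds_lower_bound hm hnm h1 h2 h3
  rw [← hQ] at hbound
  have hn0 : (0 : ℝ) ≤ n := n.cast_nonneg
  have root : ∀ x : ℝ, 0 ≤ x → (x ^ 3) ^ ((1 : ℝ) / 3) = x := fun x hx => by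
    have := Real.pow_rpow_inv_natCast hx (n := 3) (by norm_num)
    simpa using this
  have hupper : (n : ℝ) ^ ((1 : ℝ) / 3) ≤ Q * (2 * r + 10 + 3 * r * ((B + 1) * T)) := by
    rw [← root (Q * (2 * r + 10 + 3 * r * ((B + 1) * T))) (by positivity)]
    exact Real.rpow_le_rpow hn0 (by exact_mod_cast hbound) (by norm_num)
  have hlower : 2 * Q * (2 * r + 10) ≤ (n : ℝ) ^ ((1 : ℝ) / 3) := by
    rw [← root (2 * Q * (2 * r + 10)) (by positivity)]
    exact Real.rpow_le_rpow (by positivity)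
      (by exact_mod_cast le_trans (Nat.le_add_right _ _) hn) (by norm_num)
  have hlog : 1 ≤ Real.log n := by
    rw [Real.le_log_iff_exp_le (by exact_mod_cast (by omega : 0 < n))]
    have : (3 : ℝ) ≤ n := by exact_mod_cast (by omega : 3 ≤ n)
    linarith [Real.exp_one_lt_d9]
  have hB1 : (B : ℝ) + 1 ≤ (|K| + 1) * Real.log n := by
    have : K * Real.log n ≤ |K| * Real.log n := by
      gcongr
      exact le_abs_self K
    linarith
  have hmain : (n : ℝ) ^ ((1 : ℝ) / 3) ≤
      2 * Q * (3 * r) * (|K| + 1) * Real.log n * T := by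
    calc (n : ℝ) ^ ((1 : ℝ) / 3) ≤ 2 * Q * (3 * r) * (B + 1) * T := by linarith
      _ ≤ 2 * Q * (3 * r) * ((|K| + 1) * Real.log n) * T := by gcongr
      _ = _ := by ring
  have hpos : 0 < 2 * Q * (3 * r) * (|K| + 1) := by positivity
  rw [div_mul_div_comm, one_mul, div_le_iff₀ (by positivity)]
  linarith
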